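/- A complex Banach algebra $A$ is said to have the strong property $(\mathbb{B})$ with a constant $r>0$ if for every complex Banach space $X$, every bounded bilinear map $\varphi : A\times A\to X$ and every $\alpha\ge 0$ such that $$\|\varphi(a,b)\|\le \alpha\|a\|\|b\| \quad\text{whenever } a,b\in A,\ ab=0,$$ one has $$\|\varphi(ab,c)-\varphi(a,bc)\|\le r\,\alpha\,\|a\|\|b\|\|c\|\qquad (a,b,c\in A).$$ **Theorem.** (i) Every (not necessarily unital) C$^*$-algebra has the strong property $(\mathbb{B})$ with the constant $288\pi(1+\sqrt2)$. (ii) For every locally compact (Hausdorff) group $G$ with left Haar measure $\mu$, the group algebra $L^1(G)=L^1(G,\mu)$, with the convolution product $(f*g)(x)=\int_G f(y)\,g(y^{-1}x)\,d\mu(y)$ and the $L^1$-norm, has the strong property $(\mathbb{B})$ with the constant $288\pi(1+\sqrt2)$. -/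

import Mathlib

open MeasureTheory

universe u v w

/-- A complex Banach algebra `A` has the strong property (B) with constant `r > 0`: for every
complex Banach space `X`, every bounded bilinear `φ : A × A → X` and every `α ≥ 0`, if
`‖φ(a, b)‖ ≤ α ‖a‖ ‖b‖` whenever `a b = 0`, then
`‖φ(a b, c) - φ(a, b c)‖ ≤ r α ‖a‖ ‖b‖ ‖c‖` for all `a, b, c`. -/
def HasStrongPropertyB (A : Type u) [NonUnitalNormedRing A] [NormedSpace ℂ A]
    [IsScalarTower ℂ A A] [SMulCommClass ℂ A A] [CompleteSpace A] (r : ℝ) : Prop :=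
  0 < r ∧
    ∀ (X : Type w) [NormedAddCommGroup X] [NormedSpace ℂ X] [CompleteSpace X]
      (φ : A →L[ℂ] A →L[ℂ] X) (α : ℝ), 0 ≤ α →
      (∀ a b : A, a * b = 0 → ‖φ a b‖ ≤ α * ‖a‖ * ‖b‖) →
      ∀ a b c : A, ‖φ (a * b) c - φ a (b * c)‖ ≤ r * α * ‖a‖ * ‖b‖ * ‖c‖

/-- The underlying Banach space `L¹(G)` of the group algebra of `G`, where `μ` is a left Haar
measure on `G`. It is a type synonym of `Lp ℂ 1 μ` that carries convolution as its product. -/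
def L1GroupAlgebra {G : Type*} [MeasurableSpace G] (μ : Measure G) : Type _ := Lp ℂ 1 μ

namespace L1GroupAlgebra

noncomputable section

section Space

variable {G : Type*} [MeasurableSpace G] {μ : Measure G}

instance : NormedAddCommGroup (L1GroupAlgebra μ) :=
  inferInstanceAs (NormedAddCommGroup (Lp ℂ 1 μ))

instance : NormedSpace ℂ (L1GroupAlgebra μ) :=
  inferInstanceAs (NormedSpace ℂ (Lp ℂ 1 μ))

instance : CompleteSpace (L1GroupAlgebra μ) :=
  inferInstanceAs (CompleteSpace (Lp ℂ 1 μ))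

instance : CoeFun (L1GroupAlgebra μ) fun _ => G → ℂ :=
  ⟨fun f => ((show Lp ℂ 1 μ from f) : G → ℂ)⟩

theorem integrable_coe (f : L1GroupAlgebra μ) : Integrable (f : G → ℂ) μ :=
  L1.integrable_coeFn f

theorem norm_eq_integral (f : L1GroupAlgebra μ) : ‖f‖ = ∫ y, ‖f y‖ ∂μ :=
  L1.norm_eq_integral_norm f

theorem coe_add (f g : L1GroupAlgebra μ) : ⇑(f + g) =ᵐ[μ] fun x => f x + g x :=
  Lp.coeFn_add (p := 1) (μ := μ) f g

theorem coe_smul (c : ℂ) (f : L1GroupAlgebra μ) : ⇑(c • f) =ᵐ[μ] fun x => c * f x :=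
  Lp.coeFn_smul (p := 1) (μ := μ) c f

end Space

section Translation

variable {G : Type*} [Group G] [TopologicalSpace G] [IsTopologicalGroup G]
  [MeasurableSpace G] [BorelSpace G] {μ : Measure G} [μ.IsHaarMeasure]

/-- Left translation `(τ_y g)(x) = g (y⁻¹ x)`, a linear isometry of `L¹(G)`. -/
def translate (y : G) : L1GroupAlgebra μ →ₗᵢ[ℂ] L1GroupAlgebra μ :=
  Lp.compMeasurePreservingₗᵢ ℂ (y⁻¹ * ·) (measurePreserving_mul_left μ y⁻¹)

theorem translate_ae (y : G) (g : L1GroupAlgebra μ) :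
    translate y g =ᵐ[μ] fun x => g (y⁻¹ * x) :=
  Lp.coeFn_compMeasurePreserving (μ := μ) _ (measurePreserving_mul_left μ y⁻¹)

theorem translate_eq_smul (y : G) (g : L1GroupAlgebra μ) :
    translate y g = DomMulAct.mk y⁻¹ • (show Lp ℂ 1 μ from g) := rfl

theorem translate_mul (y z : G) (g : L1GroupAlgebra μ) :
    translate (y * z) g = translate y (translate z g) := by
  simp only [translate_eq_smul, mul_inv_rev, DomMulAct.mk_mul]
  exact mul_smul (DomMulAct.mk y⁻¹) (DomMulAct.mk z⁻¹) (show Lp ℂ 1 μ from g)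

end Translation

section Convolution

variable {G : Type*} [Group G] [TopologicalSpace G] [IsTopologicalGroup G]
  [LocallyCompactSpace G] [MeasurableSpace G] [BorelSpace G]
  {μ : Measure G} [μ.IsHaarMeasure] [μ.Regular]

theorem continuous_translate (g : L1GroupAlgebra μ) : Continuous fun y : G => translate y g := by
  have : Fact ((1 : ENNReal) ≠ ⊤) := ⟨ENNReal.one_ne_top⟩
  have h : Continuous fun y : G => (DomMulAct.mk y⁻¹) • (show Lp ℂ 1 μ from g) :=
    (DomMulAct.continuous_mk.comp continuous_inv).smul continuous_const
  exact h

/-- The integrand `y ↦ f(y) τ_y g` of a convolution is Bochner integrable. -/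
theorem integrable_smul_translate (f g : L1GroupAlgebra μ) :
    Integrable (fun y => f y • translate y g) μ := by
  have key : AEStronglyMeasurable (fun y => f y • translate y g) μ := by
    refine Integrable.induction
      (fun k : G → ℂ => AEStronglyMeasurable (fun y => k y • translate y g) μ)
      (fun c s hs hμs => ?_) (fun k l _ _ _ hk hl => ?_) ?_ (fun k l hkl _ hk => ?_)
      (integrable_coe f)
    · have hK : ∀ n : ℕ, ∃ K ⊆ s, IsCompact K ∧ IsClosed K ∧ μ (s \ K) < ((n : ENNReal) + 1)⁻¹ :=
        fun n => hs.exists_isCompact_isClosed_sdiff_lt hμs.ne (by simp)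
      choose K hKs hKc hKcl hKμ using hK
      have hnull : μ (s \ ⋃ n, K n) = 0 := by
        refine le_antisymm (ge_of_tendsto' ((Filter.tendsto_add_atTop_iff_nat 1).2
          ENNReal.tendsto_inv_nat_nhds_zero) fun n => ?_) bot_le
        refine (measure_mono (Set.sdiff_subset_sdiff_right (Set.subset_iUnion K n))).trans ?_
        simpa using (hKμ n).le
      have h1 : AEStronglyMeasurable (fun y => translate y g) (μ.restrict (⋃ n, K n)) :=
        aestronglyMeasurable_iUnion_iff.2 fun n =>
          (continuous_translate g).continuousOn.aestronglyMeasurable_of_isCompact (hKc n)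
            (hKcl n).measurableSet
      have h2 : μ.restrict (⋃ n, K n) = μ.restrict s :=
        Measure.restrict_congr_set ((LE.le.eventuallyLE (Set.iUnion_subset hKs)).antisymm
          (ae_le_set.2 hnull))
      rw [h2] at h1
      have h3 : (fun y => s.indicator (fun _ => c) y • translate y g)
          = s.indicator fun y => c • translate y g := by
        funext y
        by_cases hy : y ∈ s <;> simp [hy]
      rw [h3]
      exact (aestronglyMeasurable_indicator_iff hs).2 (h1.const_smul c)
    · simpa only [Pi.add_apply, add_smul] using! hk.add hl
    · refine IsSeqClosed.isClosed fun k l hk hkl => ?_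
      obtain ⟨ns, -, hns⟩ := (tendstoInMeasure_of_tendsto_Lp hkl).exists_seq_tendsto_ae
      refine aestronglyMeasurable_of_tendsto_ae Filter.atTop
        (f := fun n y => k (ns n) y • translate y g) (fun n => hk (ns n)) ?_
      filter_upwards [hns] with y hy
      exact hy.smul_const _
    · refine hk.congr ?_
      filter_upwards [hkl] with y hy
      rw [hy]
  exact ((integrable_coe f).norm.mul_const ‖g‖).mono' key
    (.of_forall fun y => by rw [norm_smul, LinearIsometry.norm_map])

/-- Convolution of `f, g ∈ L¹(G)` as an `L¹(G)`-valued Bochner integral: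
`f * g = ∫ f(y) τ_y g dμ(y)`, that is, `(f * g)(x) = ∫ f(y) g(y⁻¹ x) dμ(y)`. -/
instance : Mul (L1GroupAlgebra μ) :=
  ⟨fun f g => ∫ y, f y • translate y g ∂μ⟩

theorem mul_def (f g : L1GroupAlgebra μ) : f * g = ∫ y, f y • translate y g ∂μ := rfl

theorem conv_add (f g h : L1GroupAlgebra μ) : f * (g + h) = f * g + f * h := by
  simp only [mul_def, map_add, smul_add]
  exact integral_add (integrable_smul_translate f g) (integrable_smul_translate f h)

theorem add_conv (f g h : L1GroupAlgebra μ) : (f + g) * h = f * h + g * h := by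
  simp only [mul_def]
  rw [← integral_add (integrable_smul_translate f h) (integrable_smul_translate g h)]
  refine integral_congr_ae ?_
  filter_upwards [coe_add f g] with y hy
  rw [hy, add_smul]

theorem conv_smul (c : ℂ) (f g : L1GroupAlgebra μ) : f * (c • g) = c • (f * g) := by
  simp only [mul_def, map_smul, ← integral_smul]
  simp only [smul_comm c]

theorem smul_conv (c : ℂ) (f g : L1GroupAlgebra μ) : (c • f) * g = c • (f * g) := by
  simp only [mul_def, ← integral_smul]
  refine integral_congr_ae ?_
  filter_upwards [coe_smul c f] with y hy
  rw [hy, mul_smul]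

theorem norm_conv_le (f g : L1GroupAlgebra μ) : ‖f * g‖ ≤ ‖f‖ * ‖g‖ := by
  rw [mul_def, norm_eq_integral f, ← integral_mul_const]
  refine (norm_integral_le_integral_norm _).trans (le_of_eq ?_)
  simp only [norm_smul, LinearIsometry.norm_map]

/-- Right convolution `f ↦ f * h` as a bounded operator. -/
def convRight (h : L1GroupAlgebra μ) : L1GroupAlgebra μ →L[ℂ] L1GroupAlgebra μ :=
  LinearMap.mkContinuous
    { toFun := fun f => f * h
      map_add' := fun f g => add_conv f g h
      map_smul' := fun c f => smul_conv c f h } ‖h‖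
    fun f => (norm_conv_le f h).trans_eq (mul_comm _ _)

theorem translate_conv (y : G) (f g : L1GroupAlgebra μ) :
    translate y f * g = translate y (f * g) := by
  have h1 : translate y (f * g) = ∫ z, f z • translate (y * z) g ∂μ := by
    rw [mul_def]
    refine ((translate y).toContinuousLinearMap.integral_comp_comm
      (integrable_smul_translate f g)).symm.trans ?_
    refine integral_congr_ae (.of_forall fun z => ?_)
    simp [translate_mul]
  rw [h1, mul_def, ← integral_mul_left_eq_self _ y]
  refine integral_congr_ae ?_
  filter_upwards [(measurePreserving_mul_left μ y).quasiMeasurePreserving.ae (translate_ae y f)]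
    with z hz
  simp only [hz, inv_mul_cancel_left]

theorem conv_assoc (f g h : L1GroupAlgebra μ) : f * g * h = f * (g * h) := by
  have h1 : convRight h (f * g) = ∫ y, convRight h (f y • translate y g) ∂μ :=
    ((convRight h).integral_comp_comm (integrable_smul_translate f g)).symm
  refine h1.trans ?_
  rw [mul_def f]
  refine integral_congr_ae (.of_forall fun y => ?_)
  change (f y • translate y g) * h = f y • translate y (g * h)
  rw [smul_conv, translate_conv]

/-- `L¹(G)` with convolution is a Banach algebra. -/
instance : NonUnitalNormedRing (L1GroupAlgebra μ) :=
  { (inferInstance : NormedAddCommGroup (L1GroupAlgebra μ)),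
    (inferInstance : Mul (L1GroupAlgebra μ)) with
    left_distrib := conv_add
    right_distrib := add_conv
    zero_mul := fun f => (convRight f).map_zero
    mul_zero := fun f => by simp [mul_def]
    mul_assoc := conv_assoc
    norm_mul_le := norm_conv_le }

instance : IsScalarTower ℂ (L1GroupAlgebra μ) (L1GroupAlgebra μ) :=
  ⟨fun c f g => smul_conv c f g⟩

instance : SMulCommClass ℂ (L1GroupAlgebra μ) (L1GroupAlgebra μ) :=
  ⟨fun c f g => (conv_smul c f g).symm⟩

end Convolution

end

end L1GroupAlgebra

/-!
Two functions on the circle that are supported on complementary half circles have product zero. Put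
their Fourier coefficients as weights on bounded families `p`, `q` in a Banach algebra for which
`p m * q n` depends only on `m - n`: the resulting trigonometric series again have product zero at
every point of the circle, so `φ` is small on them by hypothesis. Averaging over the circle leaves
the sum of the `φ (p n) (q n)` weighted by products of Fourier coefficients, and for suitable bumps
this is the fourth difference of `f n = φ (p n) (q n)`. The same bound holds for every step. Since
`Δ_{2h} = 2 Δ_h + Δ_h ^ 2`, comparing step `h` with step `2h` shows that a bounded function whose
fourth differences are uniformly small has small first differences as well.

For a C⋆-algebra, take `p n = a uⁿ` and `q n = u¹⁻ⁿ c` with `u` a unitary multiplier; every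
multiplier is a combination of four unitaries. For `L¹(G)`, take translates by the powers of a
point `y` in place of `u`, and integrate over `y` against `b`. The integral of the right translates
of `a` represents `a * b` only up to an element that annihilates `c`, on which the hypothesis on `φ`
applies directly.
-/

namespace StrongPropertyB

noncomputable section

section HalfCircle

open AddCircle Complex
open scoped ComplexConjugate fwdDiff Real

theorem hasSum_conj_fourierCoeff_mul {T : ℝ} [Fact (0 < T)] {f g : AddCircle T → ℂ}
    (hf : MemLp f 2 haarAddCircle) (hg : MemLp g 2 haarAddCircle) :
    HasSum (fun n => conj (fourierCoeff f n) * fourierCoeff g n)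
      (∫ x, conj (f x) * g x ∂haarAddCircle) := by
  have h := (fourierBasis (T := T)).hasSum_inner_mul_inner (hf.toLp f) (hg.toLp g)
  rw [L2.inner_def] at h
  simp only [← inner_conj_symm (hf.toLp f), ← fourierBasis.repr_apply_apply, fourierBasis_repr,
    fourierCoeff_congr_ae hf.coeFn_toLp, fourierCoeff_congr_ae hg.coeFn_toLp] at h
  convert! h using 1
  refine integral_congr_ae (μ := haarAddCircle (T := T)) ?_
  filter_upwards [hf.coeFn_toLp, hg.coeFn_toLp] with x hfx hgx
  rw [hfx, hgx, RCLike.inner_apply']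

theorem fourierCoeff_fourier_mul {T : ℝ} [Fact (0 < T)] (f : AddCircle T → ℂ) (d n : ℤ) :
    fourierCoeff (fun x => fourier d x * f x) n = fourierCoeff f (n - d) := by
  refine integral_congr_ae (.of_forall fun x => ?_)
  simp only [smul_eq_mul, ← mul_assoc, ← fourier_add]
  congr 3
  ring

/-- The indicator function of a half circle. -/
def halfCircle : UnitAddCircle → ℂ := liftIoc 1 0 ((Set.Iic (1 / 2 : ℝ)).indicator 1)

/-- The Fourier coefficients of `halfCircle`. -/
def halfCircleCoeff (n : ℤ) : ℂ := fourierCoeff halfCircle n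

theorem halfCircleCoeff_eq_integral (n : ℤ) :
    halfCircleCoeff n = ∫ x in (0 : ℝ)..1 / 2, fourier (-n) (x : UnitAddCircle) := by
  have hsub : Set.Ioc (0 : ℝ) 1 ∩ Set.Iic (1 / 2) = Set.Ioc 0 (1 / 2) := by
    rw [Set.Ioc_inter_Iic]
    norm_num
  rw [halfCircleCoeff, halfCircle, fourierCoeff_liftIoc_eq, fourierCoeffOn_eq_integral,
    intervalIntegral.integral_of_le (by norm_num), intervalIntegral.integral_of_le (by norm_num),
    ← hsub, ← setIntegral_indicator measurableSet_Iic]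
  simp only [fourier_coe_apply, Set.indicator_apply, Pi.one_apply, zero_add, sub_zero, div_one,
    one_smul, smul_eq_mul, mul_ite, mul_one, mul_zero]

theorem halfCircleCoeff_zero : halfCircleCoeff 0 = 1 / 2 := by
  rw [halfCircleCoeff_eq_integral]
  simp

theorem halfCircleCoeff_of_ne_zero {n : ℤ} (hn : n ≠ 0) :
    halfCircleCoeff n = (1 - (-1) ^ n) / (2 * π * I * n) := by
  have hderiv (x : ℝ) := has_antideriv_at_fourier_neg (T := 1) inferInstance hn x
  have hcont : Continuous fun x : ℝ => fourier (-n) (x : UnitAddCircle) :=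
    (map_continuous _).comp (AddCircle.continuous_mk' 1)
  have hhalf : fourier (-n) ((1 / 2 : ℝ) : UnitAddCircle) = ((-1) ^ n : ℂ) := by
    rw [fourier_coe_apply, ← inv_neg_one, inv_zpow', ← exp_pi_mul_I, ← exp_int_mul]
    congr 1
    push_cast
    ring
  rw [halfCircleCoeff_eq_integral, intervalIntegral.integral_eq_sub_of_hasDerivAt
    (fun x _ => hderiv x) (hcont.intervalIntegrable _ _), hhalf]
  simp only [QuotientAddGroup.mk_zero, fourier_eval_zero, ofReal_one]
  field_simp
  ring

theorem halfCircleCoeff_of_odd {n : ℤ} (hn : Odd n) : halfCircleCoeff n = 1 / (π * I * n) := by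
  rw [halfCircleCoeff_of_ne_zero (by rintro rfl; simp at hn), hn.neg_one_zpow]
  ring

theorem halfCircleCoeff_of_even {n : ℤ} (hn : Even n) (hn0 : n ≠ 0) : halfCircleCoeff n = 0 := by
  rw [halfCircleCoeff_of_ne_zero hn0, hn.neg_one_zpow, sub_self, zero_div]

theorem conj_halfCircleCoeff (n : ℤ) : conj (halfCircleCoeff n) = halfCircleCoeff (-n) := by
  rcases eq_or_ne n 0 with rfl | hn
  · rw [neg_zero, halfCircleCoeff_zero, map_div₀, map_one, map_ofNat]
  · rw [halfCircleCoeff_of_ne_zero hn, halfCircleCoeff_of_ne_zero (neg_ne_zero.2 hn)]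
    rcases Int.even_or_odd n with h | h <;>
      simp [h.neg_one_zpow, h.neg.neg_one_zpow, Complex.conj_ofNat]

theorem memLp_halfCircle : MemLp halfCircle 2 haarAddCircle := by
  have h : MemLp ((Set.Iic (1 / 2 : ℝ)).indicator (1 : ℝ → ℂ)) 2
      (volume.restrict (Set.Ioc 0 (0 + 1))) :=
    MemLp.indicator measurableSet_Iic (memLp_const 1)
  exact h.memLp_liftIoc.haarAddCircle

theorem hasSum_conj_halfCircleCoeff_mul_sub (d : ℤ) :
    HasSum (fun m => conj (halfCircleCoeff m) * halfCircleCoeff (m - d))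
      (halfCircleCoeff (-d)) := by
  have hshift : MemLp (fun x => fourier d x * halfCircle x) 2 haarAddCircle :=
    memLp_halfCircle.of_le_mul (c := 1)
      ((map_continuous (fourier d)).aestronglyMeasurable.mul memLp_halfCircle.1)
      (.of_forall fun x => by rw [norm_mul, fourier_apply, Circle.norm_coe])
  have h := hasSum_conj_fourierCoeff_mul memLp_halfCircle hshift
  simp only [fourierCoeff_fourier_mul] at h
  convert! h using 1
  refine integral_congr_ae (.of_forall fun x => ?_)
  have hidem : conj (halfCircle x) * halfCircle x = halfCircle x := by
    simp only [halfCircle, liftIoc, Function.comp, Set.domRestrict_apply, Set.indicator]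
    split_ifs <;> simp
  simp only [neg_neg, smul_eq_mul]
  rw [mul_left_comm, hidem]

theorem hasSum_norm_halfCircleCoeff_sq : HasSum (fun n => ‖halfCircleCoeff n‖ ^ 2) (1 / 2) := by
  have h := hasSum_conj_halfCircleCoeff_mul_sub 0
  simp only [sub_zero, conj_mul', neg_zero, halfCircleCoeff_zero] at h
  rw [← hasSum_ofReal]
  simpa using h

theorem halfCircleCoeff_add_neg (n : ℤ) :
    halfCircleCoeff n + halfCircleCoeff (-n) = if n = 0 then 1 else 0 := by
  split_ifs with hn
  · norm_num [hn, halfCircleCoeff_zero]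
  · rw [halfCircleCoeff_of_ne_zero hn, halfCircleCoeff_of_ne_zero (neg_ne_zero.2 hn)]
    rcases Int.even_or_odd n with h | h <;>
      simp [h.neg_one_zpow, h.neg.neg_one_zpow, div_neg]

theorem hasSum_halfCircleCoeff_mul_add (d : ℤ) :
    HasSum (fun m => halfCircleCoeff m * halfCircleCoeff (m + d)) 0 := by
  have hconv := hasSum_conj_halfCircleCoeff_mul_sub d
  have hdelta : HasSum (fun m => conj (halfCircleCoeff m) * if m - d = 0 then 1 else 0)
      (halfCircleCoeff (-d)) := by
    convert! hasSum_ite_eq d (halfCircleCoeff (-d)) using 2 with m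
    simp only [sub_eq_zero, mul_ite, mul_one, mul_zero, conj_halfCircleCoeff]
    split_ifs with h <;> simp [h]
  have h := hdelta.sub hconv
  rw [sub_self, ← (Equiv.neg ℤ).hasSum_iff] at h
  convert! h using 2 with m
  simp only [Function.comp, Equiv.neg_apply, conj_halfCircleCoeff, ← mul_sub, neg_neg,
    ← halfCircleCoeff_add_neg, add_sub_cancel_left]
  congr 2
  ring

/-- The Fourier coefficients of the function `x ↦ (1 - e^{-4πix}) * halfCircle x`. It is continuous,
and its Fourier series converges absolutely, unlike that of `halfCircle`. -/
def bumpCoeff (n : ℤ) : ℂ := halfCircleCoeff n - halfCircleCoeff (n + 2)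

theorem bumpCoeff_zero : bumpCoeff 0 = 1 / 2 := by
  rw [bumpCoeff, halfCircleCoeff_zero, halfCircleCoeff_of_even (by decide) (by decide), sub_zero]

theorem bumpCoeff_neg_two : bumpCoeff (-2) = -(1 / 2) := by
  rw [bumpCoeff, neg_add_cancel, halfCircleCoeff_zero,
    halfCircleCoeff_of_even (by decide) (by decide), zero_sub]

theorem bumpCoeff_of_even {n : ℤ} (hn : Even n) (h0 : n ≠ 0) (h2 : n ≠ -2) :
    bumpCoeff n = 0 := by
  rw [bumpCoeff, halfCircleCoeff_of_even hn h0,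
    halfCircleCoeff_of_even (hn.add even_two) (by omega), sub_zero]

theorem bumpCoeff_of_odd {n : ℤ} (hn : Odd n) : bumpCoeff n = 2 / (π * I * (n * (n + 2))) := by
  have h0 : (n : ℂ) ≠ 0 := mod_cast fun h => by grind
  have h2 : (n + 2 : ℂ) ≠ 0 := mod_cast fun h => by grind
  rw [bumpCoeff, halfCircleCoeff_of_odd hn, halfCircleCoeff_of_odd (hn.add_even even_two)]
  push_cast
  field_simp
  ring

theorem norm_bumpCoeff_le (n : ℤ) :
    ‖bumpCoeff n‖ ≤ π * (‖halfCircleCoeff n‖ ^ 2 + ‖halfCircleCoeff (n + 2)‖ ^ 2) := by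
  rcases Int.even_or_odd n with hn | hn
  · rcases eq_or_ne n 0 with rfl | h0
    · rw [bumpCoeff_zero, halfCircleCoeff_zero]
      norm_num
      nlinarith [Real.pi_gt_three, sq_nonneg ‖halfCircleCoeff 2‖]
    rcases eq_or_ne n (-2) with rfl | h2
    · rw [bumpCoeff_neg_two, neg_add_cancel, halfCircleCoeff_zero]
      norm_num
      nlinarith [Real.pi_gt_three, sq_nonneg ‖halfCircleCoeff (-2)‖]
    · rw [bumpCoeff_of_even hn h0 h2, norm_zero]
      positivity
  · have hprod : bumpCoeff n = 2 * π * I * (halfCircleCoeff n * halfCircleCoeff (n + 2)) := by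
      rw [bumpCoeff_of_odd hn, halfCircleCoeff_of_odd hn,
        halfCircleCoeff_of_odd (hn.add_even even_two)]
      push_cast
      field_simp
    rw [hprod]
    simp only [norm_mul, norm_ofNat, norm_real, norm_I, Real.norm_of_nonneg Real.pi_pos.le]
    nlinarith [mul_nonneg Real.pi_pos.le
      (sq_nonneg (‖halfCircleCoeff n‖ - ‖halfCircleCoeff (n + 2)‖))]

theorem hasSum_pi_mul_norm_halfCircleCoeff_sq :
    HasSum (fun n => π * (‖halfCircleCoeff n‖ ^ 2 + ‖halfCircleCoeff (n + 2)‖ ^ 2)) π := by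
  have hshift := (Equiv.addRight (2 : ℤ)).hasSum_iff.2 hasSum_norm_halfCircleCoeff_sq
  have h := (hasSum_norm_halfCircleCoeff_sq.add hshift).mul_left π
  rwa [add_halves, mul_one] at h

theorem summable_norm_bumpCoeff : Summable (‖bumpCoeff ·‖) :=
  .of_nonneg_of_le (fun _ => norm_nonneg _) norm_bumpCoeff_le
    hasSum_pi_mul_norm_halfCircleCoeff_sq.summable

theorem tsum_norm_bumpCoeff_le : ∑' n, ‖bumpCoeff n‖ ≤ π :=
  (summable_norm_bumpCoeff.tsum_le_tsum norm_bumpCoeff_le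
    hasSum_pi_mul_norm_halfCircleCoeff_sq.summable).trans_eq
    hasSum_pi_mul_norm_halfCircleCoeff_sq.tsum_eq

theorem summable_norm_bumpCoeff_sub (k : ℤ) : Summable fun n => ‖bumpCoeff (n - k)‖ :=
  summable_norm_bumpCoeff.comp_injective (Equiv.subRight k).injective

theorem tsum_norm_bumpCoeff_sub_le (k : ℤ) : ∑' n, ‖bumpCoeff (n - k)‖ ≤ π :=
  ((Equiv.subRight k).tsum_eq (‖bumpCoeff ·‖)).trans_le tsum_norm_bumpCoeff_le

theorem hasSum_bumpCoeff_mul_add (d : ℤ) :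
    HasSum (fun m => bumpCoeff m * bumpCoeff (m + d)) 0 := by
  have hu := hasSum_halfCircleCoeff_mul_add
  have h := ((hu d).sub (hu (d + 2))).sub (((Equiv.addRight (2 : ℤ)).hasSum_iff.2 (hu (d - 2))).sub
    ((Equiv.addRight (2 : ℤ)).hasSum_iff.2 (hu d)))
  simp only [sub_self] at h
  convert! h using 2 with m
  simp only [bumpCoeff, Function.comp, Equiv.coe_addRight]
  ring_nf

/-- The Fourier coefficients of a function supported on a half circle, normalized so that
`leftCoeff n * rightCoeff n` is the coefficient of `x n` in the fourth difference of `x` at `0`. -/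
def leftCoeff (n : ℤ) : ℂ := 3 * π * I * bumpCoeff (n - 3)

/-- The Fourier coefficients of a function supported on the same half circle as for `leftCoeff`;
`n ↦ rightCoeff (-n)` thus belongs to a function supported on the complementary half circle. -/
def rightCoeff (n : ℤ) : ℂ := bumpCoeff (n - 4) - bumpCoeff (n - 2)

theorem leftCoeff_mul_rightCoeff_natCast {k : ℕ} (hk : k ≤ 4) :
    leftCoeff k * rightCoeff k = ((-1) ^ (4 - k) * Nat.choose 4 k : ℤ) := by
  have hm1 : bumpCoeff (-1) = -(2 / (π * I)) := by
    rw [bumpCoeff_of_odd (by decide)]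
    push_cast
    field_simp
    ring
  have h1 : bumpCoeff 1 = 2 / (π * I * 3) := by
    rw [bumpCoeff_of_odd (by decide)]
    push_cast
    field_simp
    ring
  have hm3 : bumpCoeff (-3) = 2 / (π * I * 3) := by
    rw [bumpCoeff_of_odd (by decide)]
    push_cast
    field_simp
    ring
  have hm4 : bumpCoeff (-4) = 0 := bumpCoeff_of_even (by decide) (by decide) (by decide)
  have h2 : bumpCoeff 2 = 0 := bumpCoeff_of_even (by decide) (by decide) (by decide)
  interval_cases k <;>
    norm_num [leftCoeff, rightCoeff, hm1, h1, hm3, hm4, h2, bumpCoeff_zero, bumpCoeff_neg_two,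
      Nat.choose] <;>
    field_simp <;>
    norm_num

theorem leftCoeff_mul_rightCoeff_eq_zero {n : ℤ} (hn : n < 0 ∨ 4 < n) :
    leftCoeff n * rightCoeff n = 0 := by
  rcases Int.even_or_odd n with h | h
  · rw [rightCoeff, bumpCoeff_of_even (h.sub (by decide)) (by omega) (by omega),
      bumpCoeff_of_even (h.sub (by decide)) (by omega) (by omega), sub_self, mul_zero]
  · rw [leftCoeff, bumpCoeff_of_even (h.sub_odd (by decide)) (by omega) (by omega), mul_zero,
      zero_mul]

theorem hasSum_leftCoeff_mul_rightCoeff_smul {E : Type*} [NormedAddCommGroup E] [NormedSpace ℂ E]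
    (x : ℤ → E) :
    HasSum (fun n => (leftCoeff n * rightCoeff n) • x n) (Δ_[1] ^[4] x 0) := by
  have hsum : ∑ n ∈ (Finset.range 5).map Nat.castEmbedding,
      (leftCoeff n * rightCoeff n) • x n = Δ_[1] ^[4] x 0 := by
    rw [fwdDiff_iter_eq_sum_shift, Finset.sum_map]
    refine Finset.sum_congr rfl fun k hk => ?_
    rw [Nat.castEmbedding_apply, leftCoeff_mul_rightCoeff_natCast
      (Nat.lt_succ_iff.1 (Finset.mem_range.1 hk)), Int.cast_smul_eq_zsmul, zero_add, nsmul_one]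
  rw [← hsum]
  refine hasSum_sum_of_ne_finset_zero fun n hn => ?_
  rw [leftCoeff_mul_rightCoeff_eq_zero, zero_smul]
  by_contra! h
  exact hn (Finset.mem_map.2 ⟨n.toNat, by simp; omega, by simp; omega⟩)

theorem hasSum_leftCoeff_add_mul_rightCoeff (k : ℤ) :
    HasSum (fun m => leftCoeff (m + k) * rightCoeff m) 0 := by
  have h4 := (Equiv.subRight (4 : ℤ)).hasSum_iff.2 (hasSum_bumpCoeff_mul_add (k + 1))
  have h2 := (Equiv.subRight (2 : ℤ)).hasSum_iff.2 (hasSum_bumpCoeff_mul_add (k - 1))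
  have h := (h4.sub h2).mul_left (3 * π * I)
  rw [sub_zero, mul_zero] at h
  convert! h using 2 with m
  simp only [leftCoeff, rightCoeff, Function.comp, Equiv.subRight_apply]
  ring_nf

theorem summable_norm_leftCoeff : Summable (‖leftCoeff ·‖) := by
  simpa only [leftCoeff, norm_mul] using (summable_norm_bumpCoeff_sub 3).mul_left ‖3 * π * I‖

theorem tsum_norm_leftCoeff_le : ∑' n, ‖leftCoeff n‖ ≤ 3 * π ^ 2 := by
  simp only [leftCoeff, norm_mul, tsum_mul_left, norm_ofNat, norm_real, norm_I,
    Real.norm_of_nonneg Real.pi_pos.le, mul_one]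
  rw [sq, ← mul_assoc]
  gcongr
  exact tsum_norm_bumpCoeff_sub_le 3

theorem summable_norm_rightCoeff : Summable (‖rightCoeff ·‖) :=
  .of_nonneg_of_le (fun _ => norm_nonneg _) (fun _ => norm_sub_le _ _)
    ((summable_norm_bumpCoeff_sub 4).add (summable_norm_bumpCoeff_sub 2))

theorem tsum_norm_rightCoeff_le : ∑' n, ‖rightCoeff n‖ ≤ 2 * π := by
  have h4 := summable_norm_bumpCoeff_sub 4
  have h2 := summable_norm_bumpCoeff_sub 2
  calc ∑' n, ‖rightCoeff n‖ ≤ ∑' n, (‖bumpCoeff (n - 4)‖ + ‖bumpCoeff (n - 2)‖) :=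
        summable_norm_rightCoeff.tsum_le_tsum (fun _ => norm_sub_le _ _) (h4.add h2)
    _ ≤ 2 * π := by
      rw [h4.tsum_add h2]
      linarith [tsum_norm_bumpCoeff_sub_le 4, tsum_norm_bumpCoeff_sub_le 2]

theorem tsum_norm_leftCoeff_mul_tsum_norm_rightCoeff_le :
    (∑' n, ‖leftCoeff n‖) * ∑' n, ‖rightCoeff n‖ ≤ 189 := by
  have hpi : π ^ 3 ≤ 3.15 ^ 3 := pow_le_pow_left₀ Real.pi_pos.le Real.pi_lt_d2.le 3
  calc (∑' n, ‖leftCoeff n‖) * ∑' n, ‖rightCoeff n‖ ≤ 3 * π ^ 2 * (2 * π) :=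
        mul_le_mul tsum_norm_leftCoeff_le tsum_norm_rightCoeff_le
          (tsum_nonneg fun _ => norm_nonneg _) (by positivity)
    _ ≤ 189 := by linarith

end HalfCircle

section FourierSeries

open AddCircle
open scoped Real

variable {T : ℝ}
  {E F X : Type*} [NormedAddCommGroup E] [NormedSpace ℂ E] [NormedAddCommGroup F]
  [NormedSpace ℂ F] [NormedAddCommGroup X] [NormedSpace ℂ X]

theorem summable_norm_smul_of_norm_le {c : ℤ → ℂ} (hc : Summable (‖c ·‖)) {p : ℤ → E} {P : ℝ}
    (hp : ∀ n, ‖p n‖ ≤ P) : Summable fun n => ‖c n • p n‖ :=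
  .of_nonneg_of_le (fun _ => norm_nonneg _)
    (fun n => (norm_smul_le _ _).trans (mul_le_mul_of_nonneg_left (hp n) (norm_nonneg _)))
    (hc.mul_right P)

theorem tsum_norm_smul_le {c : ℤ → ℂ} (hc : Summable (‖c ·‖)) {p : ℤ → E} {P : ℝ}
    (hp : ∀ n, ‖p n‖ ≤ P) : ∑' n, ‖c n • p n‖ ≤ (∑' n, ‖c n‖) * P := by
  rw [← tsum_mul_right]
  exact (summable_norm_smul_of_norm_le hc hp).tsum_le_tsum
    (fun n => (norm_smul_le _ _).trans (mul_le_mul_of_nonneg_left (hp n) (norm_nonneg _)))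
    (hc.mul_right P)

/-- The trigonometric series with coefficients `a`. It is only used for absolutely summable
`a`. -/
def fourierSeries (a : ℤ → E) (x : AddCircle T) : E := ∑' n, fourier n x • a n

theorem norm_fourier_smul (n : ℤ) (x : AddCircle T) (v : E) : ‖fourier n x • v‖ = ‖v‖ := by
  rw [norm_smul, fourier_apply, Circle.norm_coe, one_mul]

theorem norm_fourierSeries_le {a : ℤ → E} (ha : Summable (‖a ·‖)) (x : AddCircle T) :
    ‖fourierSeries a x‖ ≤ ∑' n, ‖a n‖ :=
  tsum_of_norm_bounded ha.hasSum fun n => (norm_fourier_smul n x (a n)).le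

theorem hasSum_fourierSeries [CompleteSpace E] {a : ℤ → E} (ha : Summable (‖a ·‖))
    (x : AddCircle T) : HasSum (fun n => fourier n x • a n) (fourierSeries a x) :=
  (Summable.of_norm_bounded ha fun n => (norm_fourier_smul n x (a n)).le).hasSum

theorem continuous_fourierSeries [CompleteSpace E] {a : ℤ → E} (ha : Summable (‖a ·‖)) :
    Continuous (fourierSeries a : AddCircle T → E) :=
  continuous_tsum (fun n => (map_continuous (fourier n)).smul continuous_const) ha
    fun n x => (norm_fourier_smul n x (a n)).le

variable [Fact (0 < T)]

theorem fourierCoeff_fourierSeries [CompleteSpace E] {a : ℤ → E} (ha : Summable (‖a ·‖))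
    (n : ℤ) : fourierCoeff (fourierSeries a : AddCircle T → E) n = a n := by
  have hint (m : ℤ) :
      ∫ x : AddCircle T, fourier (-n) x • fourier m x • a m ∂haarAddCircle =
        if m = n then a n else 0 := by
    have hcoeff := congrFun (fourierCoeff_fourier (T := T) m) n
    simp only [fourierCoeff, smul_eq_mul] at hcoeff
    simp only [smul_smul]
    rw [integral_smul_const, hcoeff, Pi.single_apply, ite_smul, one_smul, zero_smul]
    rcases eq_or_ne m n with rfl | hmn
    · simp only [if_true]
    · rw [if_neg hmn, if_neg hmn.symm]
  have hcont (m : ℤ) : Continuous fun x : AddCircle T => fourier (-n) x • fourier m x • a m :=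
    (map_continuous (fourier (-n))).smul ((map_continuous (fourier m)).smul continuous_const)
  have h := hasSum_integral_of_dominated_convergence (μ := haarAddCircle (T := T))
    (fun m _ => ‖a m‖) (fun m => (hcont m).aestronglyMeasurable)
    (fun m => .of_forall fun x => by rw [norm_fourier_smul, norm_fourier_smul])
    (.of_forall fun _ => ha) (integrable_const _)
    (.of_forall fun x => (hasSum_fourierSeries ha x).const_smul (fourier (-n) x))
  simp only [hint] at h
  exact h.unique (hasSum_ite_eq n _)

theorem hasSum_apply_fourierSeries [CompleteSpace E] [CompleteSpace F] [CompleteSpace X]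
    (φ : E →L[ℂ] F →L[ℂ] X) {a : ℤ → E} {b : ℤ → F} (ha : Summable (‖a ·‖))
    (hb : Summable (‖b ·‖)) :
    HasSum (fun n => φ (a n) (b (-n)))
      (∫ x : AddCircle T, φ (fourierSeries a x) (fourierSeries b x) ∂haarAddCircle) := by
  have hcont : Continuous (fourierSeries b : AddCircle T → F) := continuous_fourierSeries hb
  have hint (n : ℤ) : ∫ x : AddCircle T, φ (fourier n x • a n) (fourierSeries b x)
      ∂haarAddCircle = φ (a n) (b (-n)) := by
    rw [← fourierCoeff_fourierSeries (T := T) hb, fourierCoeff, neg_neg,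
      ← ContinuousLinearMap.integral_comp_comm _ (Integrable.fourier_smul
        (hcont.integrable_of_hasCompactSupport (.of_compactSpace _)) n)]
    simp only [map_smul, smul_apply]
  have h := hasSum_integral_of_dominated_convergence (μ := haarAddCircle (T := T))
    (F := fun n x => φ (fourier n x • a n) (fourierSeries b x))
    (fun n _ => ‖φ‖ * ‖a n‖ * ∑' m, ‖b m‖)
    (fun n => ((φ.continuous.comp ((map_continuous (fourier n)).smul continuous_const)).clm_apply
      hcont).aestronglyMeasurable)
    (fun n => .of_forall fun x => ?_)
    (.of_forall fun _ => (ha.mul_left _).mul_right _) (integrable_const _)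
    (.of_forall fun x => ((hasSum_fourierSeries ha x).mapL φ).mapL (.apply ℂ X (fourierSeries b x)))
  · simpa only [hint, ContinuousLinearMap.apply_apply] using h
  · refine (φ.le_opNorm₂ _ _).trans ?_
    rw [norm_fourier_smul]
    gcongr
    exact norm_fourierSeries_le hb x

theorem norm_tsum_apply_le [CompleteSpace E] [CompleteSpace F] [CompleteSpace X]
    (φ : E →L[ℂ] F →L[ℂ] X) {a : ℤ → E} {b : ℤ → F} (ha : Summable (‖a ·‖))
    (hb : Summable (‖b ·‖)) {C : ℝ}
    (hC : ∀ x : AddCircle T, ‖φ (fourierSeries a x) (fourierSeries b x)‖ ≤ C) :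
    ‖∑' n, φ (a n) (b (-n))‖ ≤ C := by
  rw [(hasSum_apply_fourierSeries (T := T) φ ha hb).tsum_eq]
  simpa using norm_integral_le_of_norm_le_const (μ := haarAddCircle (T := T)) (.of_forall hC)

end FourierSeries

section Differences

open scoped fwdDiff

variable {M E : Type*} [AddCommMonoid M] [NormedAddCommGroup E]

theorem norm_fwdDiff_iter_le {f : M → E} {C : ℝ} (hf : ∀ x, ‖f x‖ ≤ C) (h : M) (k : ℕ) (x : M) :
    ‖Δ_[h] ^[k] f x‖ ≤ 2 ^ k * C := by
  induction k generalizing x with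
  | zero => simpa using hf x
  | succ k ih =>
    rw [Function.iterate_succ_apply', fwdDiff, pow_succ]
    linarith [norm_sub_le (Δ_[h] ^[k] f (x + h)) (Δ_[h] ^[k] f x), ih x, ih (x + h)]

variable [NormedSpace ℝ E]

theorem norm_fwdDiff_iter_two_nsmul_sub_le {f : M → E} {h : M} {k : ℕ} {C : ℝ}
    (hf : ∀ x, ‖Δ_[h] ^[k + 1] f x‖ ≤ C) (x : M) :
    ‖Δ_[2 • h] ^[k] f x - (2 : ℝ) ^ k • Δ_[h] ^[k] f x‖ ≤ k * 2 ^ k / 2 * C := by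
  induction k generalizing f C x with
  | zero => simp
  | succ k ih =>
    set g := Δ_[2 • h] f with hg
    have hg_eq : g = (fun y => Δ_[h] f (y + h)) + Δ_[h] f := by
      funext y
      simp only [hg, fwdDiff, Pi.add_apply, two_nsmul, add_assoc]
      abel
    have hg_iter (n : ℕ) (y : M) :
        Δ_[h] ^[n] g y = Δ_[h] ^[n + 1] f (y + h) + Δ_[h] ^[n + 1] f y := by
      rw [hg_eq, fwdDiff_iter_add, Pi.add_apply, fwdDiff_iter_comp_add,
        ← Function.iterate_succ_apply]
    have hg_bound (y : M) : ‖Δ_[h] ^[k + 1] g y‖ ≤ 2 * C := by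
      rw [hg_iter, two_mul]
      exact norm_add_le_of_le (hf _) (hf _)
    have hstep : Δ_[h] ^[k] g x - (2 : ℝ) • Δ_[h] ^[k + 1] f x = Δ_[h] ^[k + 2] f x := by
      rw [hg_iter, two_smul, Function.iterate_succ_apply' _ (k + 1), fwdDiff]
      abel
    calc ‖Δ_[2 • h] ^[k + 1] f x - (2 : ℝ) ^ (k + 1) • Δ_[h] ^[k + 1] f x‖
        = ‖(Δ_[2 • h] ^[k] g x - (2 : ℝ) ^ k • Δ_[h] ^[k] g x) +
            (2 : ℝ) ^ k • Δ_[h] ^[k + 2] f x‖ := by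
          rw [← hstep, Function.iterate_succ_apply, smul_sub, smul_smul, pow_succ,
            sub_add_sub_cancel]
      _ ≤ k * 2 ^ k / 2 * (2 * C) + 2 ^ k * C := by
          refine norm_add_le_of_le (ih hg_bound x) ?_
          rw [norm_smul, norm_pow, Real.norm_ofNat]
          gcongr
          exact hf x
      _ = (k + 1 : ℕ) * 2 ^ (k + 1) / 2 * C := by
          push_cast
          ring

theorem norm_fwdDiff_iter_le_of_succ {f : M → E} (hf : ∃ C, ∀ x, ‖f x‖ ≤ C) {k : ℕ} (hk : k ≠ 0)
    {B : ℝ} (hB : ∀ h x, ‖Δ_[h] ^[k + 1] f x‖ ≤ B) (h x : M) :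
    ‖Δ_[h] ^[k] f x‖ ≤ k * 2 ^ k / 2 / (2 ^ k - 1) * B := by
  obtain ⟨C, hC⟩ := hf
  have hbdd : BddAbove (Set.range fun z : M × M => ‖Δ_[z.1] ^[k] f z.2‖) :=
    ⟨2 ^ k * C, Set.forall_mem_range.2 fun z => norm_fwdDiff_iter_le hC z.1 k z.2⟩
  set S := ⨆ z : M × M, ‖Δ_[z.1] ^[k] f z.2‖
  have hle (h x : M) : ‖Δ_[h] ^[k] f x‖ ≤ S := le_ciSup hbdd (h, x)
  have hdouble (h x : M) : 2 ^ k * ‖Δ_[h] ^[k] f x‖ ≤ S + k * 2 ^ k / 2 * B := by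
    have := norm_le_norm_add_norm_sub (Δ_[2 • h] ^[k] f x) ((2 : ℝ) ^ k • Δ_[h] ^[k] f x)
    rw [norm_smul, norm_pow, Real.norm_ofNat] at this
    exact this.trans (add_le_add (hle _ _) (norm_fwdDiff_iter_two_nsmul_sub_le (hB h) x))
  have hpow : (1 : ℝ) < 2 ^ k := one_lt_pow₀ one_lt_two hk
  have hS : S ≤ (S + k * 2 ^ k / 2 * B) / 2 ^ k := ciSup_le fun z => by
    rw [le_div_iff₀' (by positivity)]
    exact hdouble z.1 z.2
  refine (hle h x).trans ?_
  rw [le_div_iff₀ (by positivity)] at hS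
  rw [div_mul_eq_mul_div, le_div_iff₀ (by linarith)]
  linarith

theorem norm_sub_le_of_norm_fwdDiff_iter_four_le {f : M → E} (hf : ∃ C, ∀ x, ‖f x‖ ≤ C) {B : ℝ}
    (hB : ∀ h x, ‖Δ_[h] ^[4] f x‖ ≤ B) (h x : M) : ‖f (x + h) - f x‖ ≤ 16 / 7 * B := by
  have h3 := norm_fwdDiff_iter_le_of_succ hf (k := 3) (by decide) hB
  have h2 := norm_fwdDiff_iter_le_of_succ hf (k := 2) (by decide) h3
  have h1 := norm_fwdDiff_iter_le_of_succ hf (k := 1) (by decide) h2 h x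
  rw [Function.iterate_one, fwdDiff] at h1
  exact h1.trans_eq (by norm_num; ring)

end Differences

section Averaging

open AddCircle
open scoped fwdDiff Real

variable {A : Type*} [NonUnitalNormedRing A] [NormedSpace ℂ A] [IsScalarTower ℂ A A]
  [SMulCommClass ℂ A A] [CompleteSpace A]

theorem fourierSeries_mul_fourierSeries_eq_zero {T : ℝ} {c d : ℤ → ℂ} (hc : Summable (‖c ·‖))
    (hd : Summable (‖d ·‖)) (hcd : ∀ k, HasSum (fun m => c (m + k) * d (-m)) 0)
    {p q r : ℤ → A} {P Q : ℝ} (hp : ∀ n, ‖p n‖ ≤ P) (hq : ∀ n, ‖q n‖ ≤ Q)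
    (hpq : ∀ m n, p m * q n = r (m + n)) (x : AddCircle T) :
    fourierSeries (fun n => c n • p n) x * fourierSeries (fun n => d n • q n) x = 0 := by
  have ha := summable_norm_smul_of_norm_le hc hp
  have hb := summable_norm_smul_of_norm_le hd hq
  have hsummable : Summable fun z : ℤ × ℤ =>
      (fourier z.1 x • c z.1 • p z.1) * (fourier z.2 x • d z.2 • q z.2) := by
    refine .of_norm_bounded (ha.mul_of_nonneg hb (fun _ => norm_nonneg _) fun _ => norm_nonneg _)
      fun z => (norm_mul_le _ _).trans_eq ?_
    rw [norm_fourier_smul, norm_fourier_smul]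
  have hprod := (hasSum_fourierSeries ha x).mul (hasSum_fourierSeries hb x) hsummable
  let antidiagonals : ℤ × ℤ ≃ ℤ × ℤ :=
    ⟨fun z => (z.2 + z.1, -z.2), fun z => (z.1 + z.2, -z.2), fun z => by simp, fun z => by simp⟩
  have hfiber (k : ℤ) : HasSum (fun m => (fourier (m + k) x • c (m + k) • p (m + k)) *
      (fourier (-m) x • d (-m) • q (-m))) 0 := by
    have h := (hcd k).smul_const (fourier k x • r k)
    rw [zero_smul] at h
    convert! h using 2 with m
    have hk : fourier k x = fourier (m + k) x * fourier (-m) x := by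
      rw [← fourier_add, add_neg_cancel_comm]
    simp only [smul_mul_assoc, mul_smul_comm, hpq, add_neg_cancel_comm, hk, smul_smul]
    congr 1
    ring
  exact ((antidiagonals.hasSum_iff.2 hprod).prod_fiberwise hfiber).unique hasSum_zero

variable {X : Type*} [NormedAddCommGroup X] [NormedSpace ℂ X] [CompleteSpace X]
  {φ : A →L[ℂ] A →L[ℂ] X} {α : ℝ}

theorem norm_fwdDiff_iter_four_one_le (hα : 0 ≤ α)
    (hφ : ∀ a b, a * b = 0 → ‖φ a b‖ ≤ α * ‖a‖ * ‖b‖)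
    {p q r : ℤ → A} {P Q : ℝ} (hp : ∀ n, ‖p n‖ ≤ P) (hq : ∀ n, ‖q n‖ ≤ Q)
    (hpq : ∀ m n, p m * q n = r (m - n)) :
    ‖Δ_[1] ^[4] (fun n => φ (p n) (q n)) 0‖ ≤ 189 * (α * P * Q) := by
  have hP : 0 ≤ P := (norm_nonneg _).trans (hp 0)
  have hQ : 0 ≤ Q := (norm_nonneg _).trans (hq 0)
  have hneg : Summable fun n => ‖rightCoeff (-n)‖ :=
    summable_norm_rightCoeff.comp_injective neg_injective
  have ha := summable_norm_smul_of_norm_le summable_norm_leftCoeff hp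
  have hb := summable_norm_smul_of_norm_le hneg fun n => hq (-n)
  have hzero := fourierSeries_mul_fourierSeries_eq_zero (T := 1) summable_norm_leftCoeff hneg
    (by simpa only [neg_neg] using hasSum_leftCoeff_add_mul_rightCoeff) hp (fun n => hq (-n))
    (fun m n => by rw [hpq, sub_neg_eq_add])
  have h := norm_tsum_apply_le (T := 1) φ ha hb fun x => (hφ _ _ (hzero x)).trans
    (mul_le_mul (mul_le_mul_of_nonneg_left (norm_fourierSeries_le ha x) hα)
      (norm_fourierSeries_le hb x) (norm_nonneg _)
      (mul_nonneg hα (tsum_nonneg fun _ => norm_nonneg _)))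
  simp only [map_smul, smul_apply, neg_neg, smul_smul,
    mul_comm (rightCoeff _), (hasSum_leftCoeff_mul_rightCoeff_smul _).tsum_eq] at h
  have hsumb : ∑' n, ‖rightCoeff (-n) • q (-n)‖ ≤ (∑' n, ‖rightCoeff n‖) * Q :=
    ((Equiv.neg ℤ).tsum_eq fun n => ‖rightCoeff n • q n‖).trans_le
      (tsum_norm_smul_le summable_norm_rightCoeff hq)
  calc _ ≤ α * (∑' n, ‖leftCoeff n • p n‖) * ∑' n, ‖rightCoeff (-n) • q (-n)‖ := h
    _ ≤ α * ((∑' n, ‖leftCoeff n‖) * P) * ((∑' n, ‖rightCoeff n‖) * Q) := by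
      gcongr
      exact tsum_norm_smul_le summable_norm_leftCoeff hp
    _ = ((∑' n, ‖leftCoeff n‖) * ∑' n, ‖rightCoeff n‖) * (α * P * Q) := by ring
    _ ≤ 189 * (α * P * Q) := by
      gcongr
      exact tsum_norm_leftCoeff_mul_tsum_norm_rightCoeff_le

theorem fwdDiff_iter_comp_mul_right {E : Type*} [AddCommGroup E] (f : ℤ → E) (h j : ℤ) (k : ℕ) :
    Δ_[1] ^[k] (fun n => f (j + n * h)) 0 = Δ_[h] ^[k] f j := by
  simp only [fwdDiff_iter_eq_sum_shift, zero_add, nsmul_eq_mul, mul_one]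

theorem norm_fwdDiff_iter_four_le (hα : 0 ≤ α)
    (hφ : ∀ a b, a * b = 0 → ‖φ a b‖ ≤ α * ‖a‖ * ‖b‖)
    {p q r : ℤ → A} {P Q : ℝ} (hp : ∀ n, ‖p n‖ ≤ P) (hq : ∀ n, ‖q n‖ ≤ Q)
    (hpq : ∀ m n, p m * q n = r (m - n)) (h j : ℤ) :
    ‖Δ_[h] ^[4] (fun n => φ (p n) (q n)) j‖ ≤ 189 * (α * P * Q) := by
  rw [← fwdDiff_iter_comp_mul_right]
  exact norm_fwdDiff_iter_four_one_le hα hφ (r := fun n => r (n * h)) (fun n => hp (j + n * h))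
    (fun n => hq (j + n * h)) fun m n => by rw [hpq]; congr 1; ring

theorem norm_apply_one_sub_apply_zero_le (hα : 0 ≤ α)
    (hφ : ∀ a b, a * b = 0 → ‖φ a b‖ ≤ α * ‖a‖ * ‖b‖)
    {p q r : ℤ → A} {P Q : ℝ} (hp : ∀ n, ‖p n‖ ≤ P) (hq : ∀ n, ‖q n‖ ≤ Q)
    (hpq : ∀ m n, p m * q n = r (m - n)) :
    ‖φ (p 1) (q 1) - φ (p 0) (q 0)‖ ≤ 432 * (α * P * Q) := by
  have hbounded : ∃ C, ∀ n, ‖φ (p n) (q n)‖ ≤ C :=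
    ⟨‖φ‖ * P * Q, fun n => φ.le_of_opNorm₂_le_of_le le_rfl (hp n) (hq n)⟩
  have h := norm_sub_le_of_norm_fwdDiff_iter_four_le hbounded
    (norm_fwdDiff_iter_four_le hα hφ hp hq hpq) 1 0
  rw [zero_add] at h
  exact h.trans_eq (by ring)

end Averaging

section CStarAlgebra

open scoped MultiplierAlgebra

variable {A X : Type*} [NonUnitalCStarAlgebra A] [NormedAddCommGroup X] [NormedSpace ℂ X]
  [CompleteSpace X] {φ : A →L[ℂ] A →L[ℂ] X} {α : ℝ}

theorem norm_coe_unitary_le_one {B : Type*} [NormedRing B] [StarRing B] [CStarRing B]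
    (u : unitary B) : ‖(u : B)‖ ≤ 1 := by
  cases subsingleton_or_nontrivial B
  · rw [norm_of_subsingleton]
    exact zero_le_one
  · exact (CStarRing.norm_coe_unitary u).le

theorem norm_fst_unitary_apply_le (u : unitary 𝓜(ℂ, A)) (a : A) :
    ‖(u : 𝓜(ℂ, A)).fst a‖ ≤ ‖a‖ := by
  have hu := norm_coe_unitary_le_one u
  rw [← DoubleCentralizer.norm_fst] at hu
  simpa using (u : 𝓜(ℂ, A)).fst.le_of_opNorm_le hu a

theorem norm_snd_unitary_apply_le (u : unitary 𝓜(ℂ, A)) (a : A) :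
    ‖(u : 𝓜(ℂ, A)).snd a‖ ≤ ‖a‖ := by
  have hu := norm_coe_unitary_le_one u
  rw [← DoubleCentralizer.norm_snd] at hu
  simpa using (u : 𝓜(ℂ, A)).snd.le_of_opNorm_le hu a

theorem norm_apply_snd_sub_apply_fst_le_of_unitary (hα : 0 ≤ α)
    (hφ : ∀ a b, a * b = 0 → ‖φ a b‖ ≤ α * ‖a‖ * ‖b‖) (u : unitary 𝓜(ℂ, A)) (a c : A) :
    ‖φ ((u : 𝓜(ℂ, A)).snd a) c - φ a ((u : 𝓜(ℂ, A)).fst c)‖ ≤ 432 * (α * ‖a‖ * ‖c‖) := by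
  have h := norm_apply_one_sub_apply_zero_le hα hφ
    (p := fun n => (u ^ n : unitary 𝓜(ℂ, A)).1.snd a)
    (q := fun n => (u ^ (1 - n) : unitary 𝓜(ℂ, A)).1.fst c)
    (r := fun n => a * (u ^ (n + 1) : unitary 𝓜(ℂ, A)).1.fst c)
    (fun n => norm_snd_unitary_apply_le _ a) (fun n => norm_fst_unitary_apply_le _ c)
    fun m n => ?_
  · simpa using h
  · rw [DoubleCentralizer.central, ← mul_apply_eq_comp, ← DoubleCentralizer.mul_fst,
      ← Submonoid.coe_mul, ← zpow_add]
    ring_nf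

theorem norm_apply_snd_sub_apply_fst_le (hα : 0 ≤ α)
    (hφ : ∀ a b, a * b = 0 → ‖φ a b‖ ≤ α * ‖a‖ * ‖b‖) (x : 𝓜(ℂ, A)) (a c : A) :
    ‖φ (x.snd a) c - φ a (x.fst c)‖ ≤ 864 * α * ‖a‖ * ‖x‖ * ‖c‖ := by
  obtain ⟨u, t, hx, ht⟩ := CStarAlgebra.exists_sum_four_unitary x
  have hdecomp : φ (x.snd a) c - φ a (x.fst c) =
      ∑ i, t i • (φ ((u i : 𝓜(ℂ, A)).snd a) c - φ a ((u i : 𝓜(ℂ, A)).fst c)) := by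
    rw [hx]
    simp only [Fin.sum_univ_four, DoubleCentralizer.add_fst, DoubleCentralizer.add_snd,
      DoubleCentralizer.smul_fst, DoubleCentralizer.smul_snd, add_apply, smul_apply, map_add,
      map_smul, smul_sub]
    abel
  calc ‖φ (x.snd a) c - φ a (x.fst c)‖
      ≤ ∑ _i : Fin 4, ‖x‖ / 2 * (432 * (α * ‖a‖ * ‖c‖)) := by
        rw [hdecomp]
        refine norm_sum_le_of_le _ fun i _ => ?_
        rw [norm_smul]
        gcongr
        exacts [ht i, norm_apply_snd_sub_apply_fst_le_of_unitary hα hφ (u i) a c]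
    _ = 864 * α * ‖a‖ * ‖x‖ * ‖c‖ := by
        rw [Fin.sum_const, nsmul_eq_mul]
        ring

theorem hasStrongPropertyB_of_nonUnitalCStarAlgebra (A : Type u) [NonUnitalCStarAlgebra A] :
    HasStrongPropertyB.{u, w} A 864 := by
  refine ⟨by norm_num, fun X _ _ _ φ α hα hφ a b c => ?_⟩
  have h := norm_apply_snd_sub_apply_fst_le hα hφ (b : 𝓜(ℂ, A)) a c
  have hb : ‖(b : 𝓜(ℂ, A))‖ = ‖b‖ := by
    rw [← DoubleCentralizer.norm_fst, DoubleCentralizer.coe_fst,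
      ContinuousLinearMap.opNorm_mul_apply]
  rwa [hb, DoubleCentralizer.coe_snd, DoubleCentralizer.coe_fst] at h

end CStarAlgebra

section CompactlySupported

theorem norm_smul_sub_indicator_le {Y E : Type*} [NormedAddCommGroup E] [NormedSpace ℝ E]
    {f : Y → ℝ} {K U t : Set Y} (hf01 : ∀ x, f x ∈ Set.Icc 0 1) (hfK : ∀ x ∈ K, f x = 1)
    (hfU : ∀ x ∉ U, f x = 0) (hKt : K ⊆ t) (c : E) (x : Y) :
    ‖f x • c - t.indicator (fun _ => c) x‖ ≤ ‖((U ∪ t) \ K).indicator (fun _ => c) x‖ := by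
  by_cases hx : x ∈ (U ∪ t) \ K
  · have hfx : ‖f x - t.indicator (fun _ => 1) x‖ ≤ 1 := by
      obtain ⟨hf0, hf1⟩ := hf01 x
      rw [Real.norm_eq_abs, abs_le]
      by_cases hxt : x ∈ t <;> simp only [hxt, Set.indicator_of_mem, Set.indicator_of_notMem,
        not_false_eq_true] <;> constructor <;> linarith
    have hsub : f x • c - t.indicator (fun _ => c) x = (f x - t.indicator (fun _ => 1) x) • c := by
      by_cases hxt : x ∈ t <;> simp [hxt, sub_smul]
    rw [Set.indicator_of_mem hx, hsub, norm_smul]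
    exact mul_le_of_le_one_left (norm_nonneg c) hfx
  · rw [Set.indicator_of_notMem hx, norm_zero, norm_le_zero_iff, sub_eq_zero]
    by_cases hxK : x ∈ K
    · simp [hfK x hxK, hKt hxK]
    · obtain ⟨hxU, hxt⟩ : x ∉ U ∧ x ∉ t := by simpa [hxK] using hx
      simp [hfU x hxU, hxt]

variable {Y E : Type*} [TopologicalSpace Y] [R1Space Y] [LocallyCompactSpace Y]
  [MeasurableSpace Y] [BorelSpace Y] {μ : Measure Y} [μ.Regular]
  [NormedAddCommGroup E] [NormedSpace ℝ E] {p : ENNReal}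

theorem exists_hasCompactSupport_eLpNorm_sub_indicator_le (hp : p ≠ ⊤) (c : E) {t : Set Y}
    (ht : MeasurableSet t) (htμ : μ t ≠ ⊤) {ε : ENNReal} (hε : ε ≠ 0) :
    ∃ g : Y → E, eLpNorm (g - t.indicator fun _ => c) p μ ≤ ε ∧
      Continuous g ∧ HasCompactSupport g := by
  obtain ⟨η, hη, hηε⟩ := exists_eLpNorm_indicator_le (μ := μ) hp c hε
  have hη2 : (η : ENNReal) / 2 ≠ 0 := by simpa using hη.ne'
  obtain ⟨K, hKt, hK, hKcl, hKμ⟩ := ht.exists_isCompact_isClosed_sdiff_lt htμ hη2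
  obtain ⟨U, hKU, hU, -, hUμ⟩ :=
    hKcl.measurableSet.exists_isOpen_sdiff_lt (μ := μ) hK.measure_ne_top hη2
  obtain ⟨f, hfK, hf, hfU, hf01⟩ := exists_continuousMap_one_of_isCompact_subset_isOpen hK hU hKU
  refine ⟨fun x => f x • c, (eLpNorm_mono fun x => ?_).trans (hηε ((U ∪ t) \ K) ?_),
    by fun_prop, HasCompactSupport.smul_right hf⟩
  · exact norm_smul_sub_indicator_le hf01 (fun x hx => hfK hx)
      (fun x hx => image_eq_zero_of_notMem_tsupport fun h => hx (hfU h)) hKt c x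
  · calc μ ((U ∪ t) \ K) ≤ μ (U \ K) + μ (t \ K) := by
          rw [Set.union_sdiff_distrib]
          exact measure_union_le _ _
      _ ≤ η / 2 + η / 2 := add_le_add hUμ.le hKμ.le
      _ = η := ENNReal.add_halves _

theorem exists_hasCompactSupport_eLpNorm_sub_le (hp : p ≠ ⊤) {f : Y → E} (hf : MemLp f p μ)
    {ε : ENNReal} (hε : ε ≠ 0) :
    ∃ g : Y → E, eLpNorm (f - g) p μ ≤ ε ∧ Continuous g ∧ HasCompactSupport g := by
  refine hf.induction_dense hp _ (fun c t ht htμ ε hε => ?_) ?_ ?_ hε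
  · exact exists_hasCompactSupport_eLpNorm_sub_indicator_le hp c ht htμ.ne hε
  · exact fun f g hf hg => ⟨hf.1.add hg.1, hf.2.add hg.2⟩
  · exact fun f hf => (hf.1.stronglyMeasurable_of_hasCompactSupport hf.2).aestronglyMeasurable

end CompactlySupported

section RightTranslation

open Measure
open scoped Pointwise

variable {G : Type*} [Group G] [TopologicalSpace G] [IsTopologicalGroup G]

theorem exists_isCompact_forall_comp_mul_right_eq_zero {M : Type*} [Zero M] {g : G → M}
    (hg : HasCompactSupport g) {V : Set G} (hV : IsCompact V) :
    ∃ K, IsCompact K ∧ ∀ y ∈ V, ∀ x ∉ K, g (x * y) = 0 := by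
  refine ⟨tsupport g * V⁻¹, hg.isCompact.mul hV.inv, fun y hy x hx => ?_⟩
  refine image_eq_zero_of_notMem_tsupport fun h => hx ?_
  exact ⟨x * y, h, y⁻¹, by simpa using hy, by simp⟩

variable [LocallyCompactSpace G]

theorem modularCharacterFun_mul_modularCharacterFun_inv (y : G) :
    modularCharacterFun y * modularCharacterFun y⁻¹ = 1 := by
  rw [← modularCharacterFun_map_mul, mul_inv_cancel, modularCharacterFun_map_one]

variable [MeasurableSpace G] [BorelSpace G] {μ : Measure G}

theorem continuousAt_integral_norm_comp_mul_right_sub [IsFiniteMeasureOnCompacts μ] {E : Type*}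
    [NormedAddCommGroup E] {g : G → E} (hg : Continuous g) (hgs : HasCompactSupport g) (y₀ : G) :
    ContinuousAt (fun y => ∫ x, ‖g (x * y) - g (x * y₀)‖ ∂μ) y₀ := by
  obtain ⟨V, hV, hVy⟩ := exists_compact_mem_nhds y₀
  obtain ⟨K, hK, hKg⟩ := exists_isCompact_forall_comp_mul_right_eq_zero hgs hV
  refine (continuousOn_integral_of_compact_support hK ?_ fun y x hy hx => ?_).continuousAt hVy
  · exact Continuous.continuousOn (by fun_prop)
  · rw [hKg y hy x hx, hKg y₀ (mem_of_mem_nhds hVy) x hx, sub_zero, norm_zero]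

variable [μ.IsHaarMeasure] [μ.Regular]

theorem map_mul_right_eq_modularCharacterFun_smul (y : G) :
    map (· * y) μ = modularCharacterFun y • μ := by
  have : (map (· * y) μ).Regular := Regular.map (Homeomorph.mulRight y)
  rw [modularCharacterFun_eq_haarScalarFactor μ y]
  exact isMulLeftInvariant_eq_smul_of_regular _ μ

theorem quasiMeasurePreserving_mul_right (y : G) : QuasiMeasurePreserving (· * y) μ μ :=
  ⟨measurable_mul_const y, by
    rw [map_mul_right_eq_modularCharacterFun_smul]
    exact smul_absolutelyContinuous⟩

theorem integrable_comp_mul_right {E : Type*} [NormedAddCommGroup E] {g : G → E}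
    (hg : Integrable g μ) (y : G) : Integrable (fun x => g (x * y)) μ := by
  refine (integrable_map_equiv (MeasurableEquiv.mulRight y) g).1 ?_
  rw [MeasurableEquiv.coe_mulRight, map_mul_right_eq_modularCharacterFun_smul]
  exact hg.smul_measure_nnreal

theorem integral_comp_mul_right_eq_smul {E : Type*} [NormedAddCommGroup E] [NormedSpace ℝ E]
    (g : G → E) (y : G) : ∫ x, g (x * y) ∂μ = (modularCharacterFun y : ℝ) • ∫ x, g x ∂μ := by
  have h := (measurableEmbedding_mulRight y).integral_map (μ := μ) g
  rw [← h, map_mul_right_eq_modularCharacterFun_smul, integral_smul_nnreal_measure, NNReal.smul_def]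

end RightTranslation

end

end StrongPropertyB

namespace L1GroupAlgebra

noncomputable section

open MeasureTheory.Measure (modularCharacterFun modularCharacterFun_map_one)
open StrongPropertyB

/-- The elements of `L¹(G)` that have a continuous representative with compact support. -/
def compactlySupported {G : Type*} [TopologicalSpace G] [MeasurableSpace G] (μ : Measure G) :
    Set (L1GroupAlgebra μ) :=
  {f | ∃ g : G → ℂ, Continuous g ∧ HasCompactSupport g ∧ f =ᵐ[μ] g}

theorem dense_compactlySupported {G : Type*} [TopologicalSpace G] [R1Space G]
    [LocallyCompactSpace G] [MeasurableSpace G] [BorelSpace G] (μ : Measure G) [μ.Regular] :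
    Dense (compactlySupported μ) := by
  refine Metric.dense_iff.2 fun f ε hε => ?_
  obtain ⟨g, hfg, hg, hgs⟩ := exists_hasCompactSupport_eLpNorm_sub_le ENNReal.one_ne_top
    (memLp_one_iff_integrable.2 (integrable_coe f)) (ε := ENNReal.ofReal (ε / 2)) (by simpa)
  have hgi : Integrable g μ := hg.integrable_of_hasCompactSupport hgs
  let g' : L1GroupAlgebra μ := hgi.toL1 g
  have hdist : dist f g' = (eLpNorm (fun x => f x - g x) 1 μ).toReal :=
    (Lp.dist_def (p := 1) (μ := μ) f g').trans <|
      congrArg _ (eLpNorm_congr_ae (Filter.EventuallyEq.rfl.sub hgi.coeFn_toL1))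
  refine ⟨g', Metric.mem_ball'.2 ?_, g, hg, hgs, hgi.coeFn_toL1⟩
  calc dist f g' ≤ ε / 2 :=
        hdist.trans_le (ENNReal.toReal_le_of_le_ofReal (half_pos hε).le hfg)
    _ < ε := half_lt_self hε

variable {G : Type*} [Group G] [TopologicalSpace G] [IsTopologicalGroup G]
  [LocallyCompactSpace G] [MeasurableSpace G] [BorelSpace G]
  {μ : Measure G} [μ.IsHaarMeasure] [μ.Regular]

/-- The function `x ↦ f (x y)`; its norm is `Δ(y) ‖f‖`, where `Δ` is the modular function. -/
def compMulRight (y : G) (f : L1GroupAlgebra μ) : L1GroupAlgebra μ :=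
  (integrable_comp_mul_right (integrable_coe f) y).toL1 fun x => f (x * y)

theorem compMulRight_ae (y : G) (f : L1GroupAlgebra μ) :
    compMulRight y f =ᵐ[μ] fun x => f (x * y) :=
  Integrable.coeFn_toL1 _

theorem compMulRight_one (f : L1GroupAlgebra μ) : compMulRight 1 f = f := by
  refine Lp.ext (p := 1) (μ := μ) ((compMulRight_ae 1 f).trans ?_)
  simp only [mul_one]
  rfl

theorem norm_compMulRight (y : G) (f : L1GroupAlgebra μ) :
    ‖compMulRight y f‖ = modularCharacterFun y * ‖f‖ := by
  rw [norm_eq_integral f, ← smul_eq_mul, ← integral_comp_mul_right_eq_smul (fun x => ‖f x‖)]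
  exact L1.norm_of_fun_eq_integral_norm _

theorem continuous_compMulRight {f : L1GroupAlgebra μ} (hf : f ∈ compactlySupported μ) :
    Continuous fun y => compMulRight y f := by
  obtain ⟨g, hg, hgs, hfg⟩ := hf
  have hnorm (y y₀ : G) :
      ‖compMulRight y f - compMulRight y₀ f‖ = ∫ x, ‖g (x * y) - g (x * y₀)‖ ∂μ := by
    rw [norm_eq_integral]
    refine integral_congr_ae ?_
    filter_upwards [Lp.coeFn_sub (p := 1) (μ := μ) (compMulRight y f) (compMulRight y₀ f),
      compMulRight_ae y f, compMulRight_ae y₀ f, (quasiMeasurePreserving_mul_right y).ae hfg,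
      (quasiMeasurePreserving_mul_right y₀).ae hfg] with x hsub hy hy₀ hgy hgy₀
    rw [← hgy, ← hgy₀, ← hy, ← hy₀]
    exact congrArg norm hsub
  refine continuous_iff_continuousAt.2 fun y₀ => tendsto_iff_norm_sub_tendsto_zero.2 ?_
  simp only [hnorm]
  simpa [ContinuousAt] using continuousAt_integral_norm_comp_mul_right_sub hg hgs (μ := μ) y₀

theorem compMulRight_conv (y : G) (f c : L1GroupAlgebra μ) :
    compMulRight y f * c = (modularCharacterFun y : ℂ) • (f * translate y⁻¹ c) := by
  let k : G → L1GroupAlgebra μ := fun x => f x • translate (x * y⁻¹) c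
  calc compMulRight y f * c = ∫ x, k (x * y) ∂μ := by
        rw [mul_def]
        refine integral_congr_ae ?_
        filter_upwards [compMulRight_ae y f] with x hx
        simp only [k, hx, mul_inv_cancel_right]
    _ = (modularCharacterFun y : ℂ) • ∫ x, k x ∂μ := by
        rw [integral_comp_mul_right_eq_smul, Complex.coe_smul]
    _ = (modularCharacterFun y : ℂ) • (f * translate y⁻¹ c) := by
        simp only [k, mul_def, translate_mul]

/-- Right translation `x ↦ Δ(y) f (x y⁻¹)`, where `Δ` is the modular function; this is the
convolution of `f` with the point mass at `y`. -/
def rightTranslate (y : G) (f : L1GroupAlgebra μ) : L1GroupAlgebra μ :=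
  (modularCharacterFun y : ℂ) • compMulRight y⁻¹ f

theorem rightTranslate_one (f : L1GroupAlgebra μ) : rightTranslate 1 f = f := by
  simp [rightTranslate, modularCharacterFun_map_one, compMulRight_one]

theorem norm_rightTranslate (y : G) (f : L1GroupAlgebra μ) : ‖rightTranslate y f‖ = ‖f‖ := by
  rw [rightTranslate, norm_smul, norm_compMulRight, Complex.norm_real, NNReal.norm_eq, ← mul_assoc,
    ← NNReal.coe_mul, modularCharacterFun_mul_modularCharacterFun_inv, NNReal.coe_one, one_mul]

theorem rightTranslate_conv (y : G) (f c : L1GroupAlgebra μ) :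
    rightTranslate y f * c = f * translate y c := by
  rw [rightTranslate, smul_conv, compMulRight_conv, smul_smul, inv_inv, ← Complex.ofReal_mul,
    ← NNReal.coe_mul, modularCharacterFun_mul_modularCharacterFun_inv, NNReal.coe_one,
    Complex.ofReal_one, one_smul]

theorem continuous_rightTranslate {f : L1GroupAlgebra μ} (hf : f ∈ compactlySupported μ) :
    Continuous fun y => rightTranslate y f := by
  rcases eq_or_ne f 0 with rfl | hf0
  · have hzero (y : G) : rightTranslate y (0 : L1GroupAlgebra μ) = 0 := by
      rw [← norm_eq_zero, norm_rightTranslate, norm_zero]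
    simp only [hzero, continuous_const]
  have hΔ : Continuous fun y : G => (modularCharacterFun y : ℝ) := by
    have hdiv (y : G) : (modularCharacterFun y : ℝ) = ‖compMulRight y f‖ / ‖f‖ := by
      rw [norm_compMulRight, mul_div_cancel_right₀ _ (norm_ne_zero_iff.2 hf0)]
    simp only [hdiv]
    exact (continuous_compMulRight hf).norm.div_const _
  exact (Complex.continuous_ofReal.comp hΔ).smul ((continuous_compMulRight hf).comp continuous_inv)

theorem integrable_smul_rightTranslate {a b : L1GroupAlgebra μ} (ha : a ∈ compactlySupported μ)
    (hb : b ∈ compactlySupported μ) : Integrable (fun y => b y • rightTranslate y a) μ := by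
  obtain ⟨g, hg, hgs, hbg⟩ := hb
  have h : Integrable (fun y => g y • rightTranslate y a) μ :=
    (hg.smul (continuous_rightTranslate ha)).integrable_of_hasCompactSupport hgs.smul_right
  exact h.congr (by filter_upwards [hbg] with y hy; rw [hy])

theorem integral_smul_rightTranslate_conv {a b : L1GroupAlgebra μ}
    (hab : Integrable (fun y => b y • rightTranslate y a) μ) (c : L1GroupAlgebra μ) :
    (∫ y, b y • rightTranslate y a ∂μ) * c = a * b * c := by
  calc (∫ y, b y • rightTranslate y a ∂μ) * c = ∫ y, a * (b y • translate y c) ∂μ := by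
        refine ((convRight c).integral_comp_comm hab).symm.trans ?_
        refine integral_congr_ae (.of_forall fun y => ?_)
        change b y • rightTranslate y a * c = a * b y • translate y c
        rw [smul_conv, conv_smul, rightTranslate_conv]
    _ = a * b * c := by
        rw [conv_assoc]
        exact (ContinuousLinearMap.mul ℂ (L1GroupAlgebra μ) a).integral_comp_comm
          (integrable_smul_translate b c)

theorem norm_integral_smul_rightTranslate_le (a b : L1GroupAlgebra μ) :
    ‖∫ y, b y • rightTranslate y a ∂μ‖ ≤ ‖a‖ * ‖b‖ := by
  refine (norm_integral_le_integral_norm _).trans_eq ?_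
  simp only [norm_smul, norm_rightTranslate, integral_mul_const]
  rw [← norm_eq_integral, mul_comm]

section StrongPropertyB

variable {X : Type*} [NormedAddCommGroup X] [NormedSpace ℂ X] [CompleteSpace X]
  {φ : L1GroupAlgebra μ →L[ℂ] L1GroupAlgebra μ →L[ℂ] X} {α : ℝ}

theorem norm_apply_rightTranslate_sub_apply_translate_le (hα : 0 ≤ α)
    (hφ : ∀ a b, a * b = 0 → ‖φ a b‖ ≤ α * ‖a‖ * ‖b‖) (y : G) (a c : L1GroupAlgebra μ) :
    ‖φ (rightTranslate y a) c - φ a (translate y c)‖ ≤ 432 * (α * ‖a‖ * ‖c‖) := by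
  have translate_one : translate (μ := μ) 1 c = c :=
    (translate (1 : G)).injective (by rw [← translate_mul, one_mul])
  have h := norm_apply_one_sub_apply_zero_le hα hφ (p := fun n => rightTranslate (y ^ n) a)
    (q := fun n => translate (y ^ (1 - n)) c) (r := fun n => a * translate (y ^ (n + 1)) c)
    (fun n => (norm_rightTranslate _ a).le) (fun n => ((translate _).norm_map c).le)
    fun m n => by rw [rightTranslate_conv, ← translate_mul, ← zpow_add, sub_add_eq_add_sub, add_sub]
  simpa [rightTranslate_one, translate_one] using h

theorem norm_apply_integral_sub_apply_conv_le (hα : 0 ≤ α)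
    (hφ : ∀ a b, a * b = 0 → ‖φ a b‖ ≤ α * ‖a‖ * ‖b‖) {a b : L1GroupAlgebra μ}
    (hab : Integrable (fun y => b y • rightTranslate y a) μ) (c : L1GroupAlgebra μ) :
    ‖φ (∫ y, b y • rightTranslate y a ∂μ) c - φ a (b * c)‖ ≤ 432 * (α * ‖a‖ * ‖b‖ * ‖c‖) := by
  have hleft : φ (∫ y, b y • rightTranslate y a ∂μ) c = ∫ y, b y • φ (rightTranslate y a) c ∂μ := by
    simpa using! ((φ.flip c).integral_comp_comm hab).symm
  have hright : φ a (b * c) = ∫ y, b y • φ a (translate y c) ∂μ := by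
    simpa using! ((φ a).integral_comp_comm (integrable_smul_translate b c)).symm
  have hleft_int : Integrable (fun y => b y • φ (rightTranslate y a) c) μ := by
    simpa using! (φ.flip c).integrable_comp hab
  have hright_int : Integrable (fun y => b y • φ a (translate y c)) μ := by
    simpa using! (φ a).integrable_comp (integrable_smul_translate b c)
  rw [hleft, hright, ← integral_sub hleft_int hright_int]
  calc ‖∫ y, b y • φ (rightTranslate y a) c - b y • φ a (translate y c) ∂μ‖
      ≤ ∫ y, ‖b y‖ * (432 * (α * ‖a‖ * ‖c‖)) ∂μ := by
        refine norm_integral_le_of_norm_le ((integrable_coe b).norm.mul_const _)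
          (.of_forall fun y => ?_)
        rw [← smul_sub, norm_smul]
        gcongr
        exact norm_apply_rightTranslate_sub_apply_translate_le hα hφ y a c
    _ = 432 * (α * ‖a‖ * ‖b‖ * ‖c‖) := by
        rw [integral_mul_const, ← norm_eq_integral]
        ring

theorem norm_apply_conv_sub_apply_conv_le (hα : 0 ≤ α)
    (hφ : ∀ a b, a * b = 0 → ‖φ a b‖ ≤ α * ‖a‖ * ‖b‖) {a b : L1GroupAlgebra μ}
    (hab : Integrable (fun y => b y • rightTranslate y a) μ) (c : L1GroupAlgebra μ) :
    ‖φ (a * b) c - φ a (b * c)‖ ≤ 434 * α * ‖a‖ * ‖b‖ * ‖c‖ := by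
  set T := ∫ y, b y • rightTranslate y a ∂μ with hT
  have hdefect : ‖φ (a * b - T) c‖ ≤ 2 * (α * ‖a‖ * ‖b‖ * ‖c‖) := by
    have hzero : (a * b - T) * c = 0 := by
      rw [sub_mul, hT, integral_smul_rightTranslate_conv hab, sub_self]
    have hnorm : ‖a * b - T‖ ≤ 2 * (‖a‖ * ‖b‖) := by
      linarith [norm_sub_le (a * b) T, norm_conv_le a b, norm_integral_smul_rightTranslate_le a b]
    calc ‖φ (a * b - T) c‖ ≤ α * ‖a * b - T‖ * ‖c‖ := hφ _ _ hzero
      _ ≤ α * (2 * (‖a‖ * ‖b‖)) * ‖c‖ := by gcongr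
      _ = 2 * (α * ‖a‖ * ‖b‖ * ‖c‖) := by ring
  calc ‖φ (a * b) c - φ a (b * c)‖ = ‖φ (a * b - T) c + (φ T c - φ a (b * c))‖ := by
        rw [map_sub, sub_apply, sub_add_sub_cancel]
    _ ≤ 2 * (α * ‖a‖ * ‖b‖ * ‖c‖) + 432 * (α * ‖a‖ * ‖b‖ * ‖c‖) :=
        norm_add_le_of_le hdefect (norm_apply_integral_sub_apply_conv_le hα hφ hab c)
    _ = 434 * α * ‖a‖ * ‖b‖ * ‖c‖ := by ring

end StrongPropertyB

theorem hasStrongPropertyB (G : Type v) [Group G] [TopologicalSpace G] [IsTopologicalGroup G]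
    [LocallyCompactSpace G] [MeasurableSpace G] [BorelSpace G] (μ : Measure G) [μ.IsHaarMeasure]
    [μ.Regular] : HasStrongPropertyB.{v, w} (L1GroupAlgebra μ) 434 := by
  refine ⟨by norm_num, fun X _ _ _ φ α hα hφ a b c => ?_⟩
  refine isClosed_property2 (e := ((↑) : compactlySupported μ → L1GroupAlgebra μ))
    (p := fun a b => ‖φ (a * b) c - φ a (b * c)‖ ≤ 434 * α * ‖a‖ * ‖b‖ * ‖c‖)
    (dense_compactlySupported μ).denseRange_val (isClosed_le (by fun_prop) (by fun_prop))
    (fun a b => ?_) a b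
  exact norm_apply_conv_sub_apply_conv_le hα hφ (integrable_smul_rightTranslate a.2 b.2) c

end

end L1GroupAlgebra

theorem HasStrongPropertyB.mono {A : Type u} [NonUnitalNormedRing A] [NormedSpace ℂ A]
    [IsScalarTower ℂ A A] [SMulCommClass ℂ A A] [CompleteSpace A] {r s : ℝ}
    (h : HasStrongPropertyB.{u, w} A r) (hrs : r ≤ s) : HasStrongPropertyB.{u, w} A s := by
  refine ⟨h.1.trans_le hrs, fun X _ _ _ φ α hα hφ a b c => (h.2 X φ α hα hφ a b c).trans ?_⟩
  gcongr

theorem StrongPropertyB.three_le_pi_mul_one_add_sqrt_two :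
    3 ≤ Real.pi * (1 + Real.sqrt 2) := by
  nlinarith [Real.pi_gt_three, Real.sqrt_nonneg 2]

theorem mainTheorem2_general :
    (∀ (A : Type u) [NonUnitalCStarAlgebra A], HasStrongPropertyB.{u, w} A 864) ∧
    (∀ (G : Type v) [Group G] [TopologicalSpace G] [IsTopologicalGroup G]
      [LocallyCompactSpace G] [MeasurableSpace G] [BorelSpace G]
      (μ : Measure G) [μ.IsHaarMeasure] [μ.Regular],
      HasStrongPropertyB.{v, w} (L1GroupAlgebra μ) 434) :=
  ⟨fun A _ => StrongPropertyB.hasStrongPropertyB_of_nonUnitalCStarAlgebra A,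
    fun G _ _ _ _ _ _ μ _ _ => L1GroupAlgebra.hasStrongPropertyB G μ⟩

theorem mainTheorem2 :
    (∀ (A : Type u) [NonUnitalCStarAlgebra A],
      HasStrongPropertyB.{u, w} A (288 * Real.pi * (1 + Real.sqrt 2))) ∧
    (∀ (G : Type v) [Group G] [TopologicalSpace G] [IsTopologicalGroup G]
      [LocallyCompactSpace G] [T2Space G] [MeasurableSpace G] [BorelSpace G]
      (μ : Measure G) [μ.IsHaarMeasure] [μ.Regular],
      HasStrongPropertyB.{v, w} (L1GroupAlgebra μ) (288 * Real.pi * (1 + Real.sqrt 2))) := by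
  have h := StrongPropertyB.three_le_pi_mul_one_add_sqrt_two
  exact ⟨fun A _ => (mainTheorem2_general.{u, v, w}.1 A).mono (by linarith),
    fun G _ _ _ _ _ _ _ μ _ _ => (mainTheorem2_general.{u, v, w}.2 G μ).mono (by linarith)⟩
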